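/- Let $p$ be an odd prime, $n_1\ge 1$ an integer coprime to $p$, $m$ the least positive integer with $p^m\equiv 1 \pmod{n_1}$, and $q=p^m$. Let $\alpha$ be a primitive element of $\mathbb F_q$ (a generator of $\mathbb F_q^*$), and put $N=\frac{q-1}{n_1}$, $N_1=\gcd\left(N,\frac{q-1}{p-1}\right)$ and $\theta=\alpha^N$. Let $\mathrm{Tr}$ be the trace from $\mathbb F_q$ to $\mathbb F_p$, let $D=\{\theta^i : 0\le i<n_1\}$, and let $$C_D=\{(\mathrm{Tr}(a),\mathrm{Tr}(a\theta),\dots,\mathrm{Tr}(a\theta^{n_1-1})) : a\in\mathbb F_q\}\subseteq\mathbb F_p^{n_1}.$$ For a linear code $C\subseteq \mathbb F_p^n$ and $1\le r\le \dim C$, let the $r$-th generalized Hamming weight $d_r(C)$ be the minimum, over all $r$-dimensional subspaces $U\subseteq C$, of the number of coordinates $i$ such that $x_i\ne 0$ for some $x\in U$. Suppose that $N_1=3$, $p\equiv 1\pmod 3$ and $1\le r\le \frac m3$. Then $3\mid m$, and there are integers $c_1,d_1$ with $$4p^{m/3}=c_1^2+27d_1^2,\qquad c_1\equiv 1\pmod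 3,\qquad \gcd(c_1,p)=1;$$ these conditions determine $c_1$ uniquely and $d_1$ up to sign. Moreover $$d_r(C_D)=\begin{cases}\left(1-\frac1{p^r}\right)\dfrac{q-c_1q^{1/3}}{N}, & \text{if } c_1>3|d_1|,\\[2mm] \left(1-\frac1{p^r}\right)\dfrac{q+\frac12\left(c_1-9|d_1|\right)q^{1/3}}{N}, & \text{if } c_1<3|d_1|.\end{cases}$$ -/

import Mathlib

/-- The support of a subspace `U` of `𝔽_p^ι`: the coordinates at which some vector of `U` is
nonzero. -/
def codeSupport {p : ℕ} {ι : Type*} (U : Submodule (ZMod p) (ι → ZMod p)) : Set ι :=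
  {i | ∃ x ∈ U, x i ≠ 0}

/-- The `r`-th generalized Hamming weight of a linear code `C`: the least size of the support of
an `r`-dimensional subspace of `C` (meaningful for `1 ≤ r ≤ dim C`). -/
noncomputable def generalizedHammingWeight {p : ℕ} {ι : Type*}
    (C : Submodule (ZMod p) (ι → ZMod p)) (r : ℕ) : ℕ :=
  sInf {s : ℕ | ∃ U : Submodule (ZMod p) (ι → ZMod p),
    U ≤ C ∧ Module.finrank (ZMod p) U = r ∧ (codeSupport U).ncard = s}

/-- The linear map `a ↦ c(a) = (Tr (a * d i))_i` attached to a list `d` of elements of `F`. -/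
noncomputable def traceCodeword (p : ℕ) {F : Type*} [Field F] [Algebra (ZMod p) F]
    {ι : Type*} (d : ι → F) : F →ₗ[ZMod p] (ι → ZMod p) :=
  LinearMap.pi fun i =>
    (Algebra.trace (ZMod p) F).comp (LinearMap.mulRight (ZMod p) (d i))

/-- The code `C_D = {c(a) : a ∈ F}` whose defining set `D` is enumerated by `d`. -/
noncomputable def traceCode (p : ℕ) {F : Type*} [Field F] [Algebra (ZMod p) F]
    {ι : Type*} (d : ι → F) : Submodule (ZMod p) (ι → ZMod p) :=
  LinearMap.range (traceCodeword p d)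

/-- The conditions `4 p^{m/3} = c² + 27 d²`, `c ≡ 1 (mod 3)`, `gcd(c, p) = 1` on the integers
`c, d` (used only when `3 ∣ m`). -/
def IsCubicPair (p m : ℕ) (c d : ℤ) : Prop :=
  4 * (p : ℤ) ^ (m / 3) = c ^ 2 + 27 * d ^ 2 ∧ c ≡ 1 [ZMOD 3] ∧ Int.gcd c p = 1

/-! Write `q = p ^ m` and `k = (q - 1) / 3`. Let `A a = 1 + 3 ∑ ψ (a u)`, over nonzero cubes `u`, be
the reduced cubic Gaussian period. Since `N₁ = 3`, the group generated by `𝔽_pˣ` and the `N`-th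
powers is the group of cubes. Vanishing of `Tr (a u)` is unaffected by `𝔽_pˣ`, so the weight `w` of
the codeword of `a` is given by `p N w = (p - 1) (q - A a)` (`card_traceCodeword_ne_zero`). Minimal
weight thus means maximal period.

For `a ≠ 0` the periods take the values of three roots of `X³ - 3 q X - q t`, where `t` is the sum
of the two cubic Jacobi sums (`reducedCubicPeriod_cubic`). Modulo `p`, `t` is `± (2k choose k)`.
Because `p ≡ 1 (mod 3)`, all base-`p` digits of `k` equal `(p - 1) / 3`, so `p ∤ t`. Hence every
root is exactly `p ^ (m / 3)` times an integer prime to `p`. The three cofactors are `1 (mod 3)`,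
and their symmetric functions make them `c` and `-(c ± 9 d) / 2` with `4 p ^ (m / 3) = c² + 27 d²`.
The two cases of the formula record which one is largest.

For `d_r`, the support size of an `r`-dimensional subcode is proportional to the sum of its weights,
so the minimum weight gives a lower bound. It is attained because the nonzero elements of
`𝔽_{p^(m/3)}` are all cubes: multiplying `a` by them preserves the period. An `r`-dimensional
subspace of that subfield, available as `r ≤ m / 3`, therefore gives a subcode of constant minimum
weight. -/

open Finset

/-! ### Arithmetic of the form `c² + 27 d²` -/

/-- An integer root of `X³ = p³ᵏ (3 X + t)` with `p ∤ t` has `p`-adic valuation exactly `k`. -/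
theorem exists_eq_pow_mul_of_cubic_eq {p A t : ℤ} {k : ℕ} (hp : Prime p)
    (ht : ¬ p ∣ t) (h : A ^ 3 = p ^ (3 * k) * (3 * A + t)) :
    ∃ c, A = p ^ k * c ∧ ¬ p ∣ c := by
  have hdvd : (p ^ k) ^ 3 ∣ A ^ 3 := ⟨3 * A + t, by rw [h]; ring⟩
  obtain ⟨c, rfl⟩ := (Int.pow_dvd_pow_iff (by norm_num)).1 hdvd
  refine ⟨c, rfl, fun hc => ht ?_⟩
  have h0 : (p ^ k) ^ 3 ≠ 0 := pow_ne_zero _ (pow_ne_zero _ hp.ne_zero)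
  have h1 : c ^ 3 = 3 * (p ^ k * c) + t :=
    mul_left_cancel₀ h0 (by linear_combination h)
  have h2 : p ∣ c ^ 3 := dvd_pow hc (by norm_num)
  have h3 : p ∣ 3 * (p ^ k * c) := (hc.mul_left _).mul_left _
  rw [h1] at h2
  exact (dvd_add_right h3).1 h2

/-- Three integers `≡ 1 (mod 3)` with vanishing sum and second elementary symmetric function
`-3 Q` come from a representation `4 Q = c² + 27 d²`. -/
theorem exists_cubic_representation {Q c₀ c₁ c₂ : ℤ} (h₀ : c₀ ≡ 1 [ZMOD 3])
    (h₁ : c₁ ≡ 1 [ZMOD 3]) (h₂ : c₂ ≡ 1 [ZMOD 3]) (hs : c₀ + c₁ + c₂ = 0)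
    (hq : c₀ * c₁ + c₀ * c₂ + c₁ * c₂ = -(3 * Q)) :
    ∃ c d x y : ℤ, 4 * Q = c ^ 2 + 27 * d ^ 2 ∧ 2 * x = -(c + 9 * d) ∧ 2 * y = -(c - 9 * d) ∧
      ∀ z, (z = c₀ ∨ z = c₁ ∨ z = c₂) ↔ (z = c ∨ z = x ∨ z = y) := by
  have key : ∀ a b e : ℤ, a + b + e = 0 → a * b + a * e + b * e = -(3 * Q) → 9 ∣ b - e →
      ∃ d : ℤ, 4 * Q = a ^ 2 + 27 * d ^ 2 ∧ 2 * b = -(a - 9 * d) ∧ 2 * e = -(a + 9 * d) := by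
    rintro a b e h1 h2 ⟨d, hd⟩
    refine ⟨d, ?_, by linarith, by linarith⟩
    have hb : b = e + 9 * d := by linarith
    have ha : a = -(2 * e + 9 * d) := by linarith
    subst hb ha
    linarith [h2]
  -- With `cᵢ = 1 - 3 xᵢ` the vanishing sum gives `x₀ + x₁ + x₂ = 1`. Residues mod 3 that are all
  -- equal or all distinct sum to `0`, so exactly two of the `xᵢ` agree mod 3.
  have h9 : 9 ∣ c₁ - c₂ ∨ 9 ∣ c₂ - c₀ ∨ 9 ∣ c₀ - c₁ := by
    rw [Int.modEq_iff_dvd] at h₀ h₁ h₂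
    obtain ⟨x, hx⟩ := h₀
    obtain ⟨y, hy⟩ := h₁
    obtain ⟨z, hz⟩ := h₂
    rcases (by omega : x % 3 = 0 ∨ x % 3 = 1 ∨ x % 3 = 2) with h | h | h <;>
      rcases (by omega : y % 3 = 0 ∨ y % 3 = 1 ∨ y % 3 = 2) with h' | h' | h' <;> omega
  rcases h9 with h | h | h
  · obtain ⟨d, hd, hb, he⟩ := key c₀ c₁ c₂ hs hq h
    exact ⟨c₀, d, c₂, c₁, hd, he, hb, fun z => by tauto⟩
  · obtain ⟨d, hd, hb, he⟩ := key c₁ c₂ c₀ (by linarith) (by linarith) h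
    exact ⟨c₁, d, c₀, c₂, hd, he, hb, fun z => by tauto⟩
  · obtain ⟨d, hd, hb, he⟩ := key c₂ c₀ c₁ (by linarith) (by linarith) h
    exact ⟨c₂, d, c₁, c₀, hd, he, hb, fun z => by tauto⟩

/-- If `Q` divides `c d' - c' d` for two representations of `4 Q`, they are proportional. -/
theorem cubic_representation_proportional {Q c d c' d' : ℤ} (hQ : Q ≠ 0)
    (h : 4 * Q = c ^ 2 + 27 * d ^ 2) (h' : 4 * Q = c' ^ 2 + 27 * d' ^ 2)
    (hd : Q ∣ c * d' - c' * d) : c * d' = c' * d := by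
  obtain ⟨y, hy⟩ := hd
  -- Brahmagupta's identity for the product of the two representations; since `27 > 16`, it forces
  -- `y = 0`.
  have h1 : 16 * Q ^ 2 = (c * c' + 27 * d * d') ^ 2 + 27 * (Q * y) ^ 2 := by
    rw [← hy]; linear_combination (4 * Q) * h + (c ^ 2 + 27 * d ^ 2) * h'
  have hy0 : y = 0 := by
    by_contra hne
    have : 1 ≤ y ^ 2 := by have := sq_nonneg y; have : y ^ 2 ≠ 0 := pow_ne_zero _ hne; omega
    have hQ2 : 0 < Q ^ 2 := by positivity
    nlinarith [sq_nonneg (c * c' + 27 * d * d')]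
  rw [hy0] at hy
  linarith

/-- Uniqueness of the representation `4 p ^ k = c² + 27 d²` with `c ≡ 1 (mod 3)` and `p ∤ c`. -/
theorem cubic_representation_unique {p c d c' d' : ℤ} {k : ℕ} (hp : Prime p) (hp2 : ¬ p ∣ 2)
    (h : 4 * p ^ k = c ^ 2 + 27 * d ^ 2) (h' : 4 * p ^ k = c' ^ 2 + 27 * d' ^ 2)
    (hc : c ≡ 1 [ZMOD 3]) (hc' : c' ≡ 1 [ZMOD 3]) (hpc : ¬ p ∣ c) (hpc' : ¬ p ∣ c') :
    c' = c ∧ (d' = d ∨ d' = -d) := by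
  have hQ : p ^ k ≠ 0 := pow_ne_zero _ hp.ne_zero
  rw [Int.modEq_iff_dvd] at hc hc'
  have fin : ∀ e : ℤ, 4 * p ^ k = c ^ 2 + 27 * e ^ 2 → c * d' = c' * e → c' = c ∧ d' = e := by
    intro e he hprop
    have hsq : 4 * p ^ k * (c' ^ 2 - c ^ 2) = 0 := by
      linear_combination c' ^ 2 * he - c ^ 2 * h' - 27 * (c * d' + c' * e) * hprop
    have hsq' : c' ^ 2 = c ^ 2 := by
      have := (mul_eq_zero.1 hsq).resolve_left (mul_ne_zero (by norm_num) hQ)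
      linarith
    have hcc : c' = c := by
      rcases sq_eq_sq_iff_eq_or_eq_neg.1 hsq' with h | h
      · exact h
      · omega
    refine ⟨hcc, ?_⟩
    rw [hcc] at hprop
    exact mul_left_cancel₀ (fun h0 : c = 0 => hpc (by rw [h0]; exact dvd_zero p)) hprop
  have hprod : p ^ k ∣ (c * d' - c' * d) * (c * d' + c' * d) :=
    ⟨4 * (d' ^ 2 - d ^ 2), by linear_combination d ^ 2 * h' - d' ^ 2 * h⟩
  -- If `p` divided both factors it would divide `2 c d'`, hence `d'`, hence `c'`. So one factor is
  -- prime to `p` and the other absorbs all of `p ^ k`.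
  have hor : p ^ k ∣ c * d' - c' * d ∨ p ^ k ∣ c * d' + c' * d := by
    by_cases h1 : p ∣ c * d' - c' * d
    · by_cases h2 : p ∣ c * d' + c' * d
      · rcases Nat.eq_zero_or_pos k with rfl | hk
        · simp
        · have h3 : p ∣ 2 * (c * d') := by
            have := dvd_add h1 h2
            rwa [show c * d' - c' * d + (c * d' + c' * d) = 2 * (c * d') by ring] at this
          have h4 : p ∣ d' :=
            (hp.dvd_or_dvd ((hp.dvd_or_dvd h3).resolve_left hp2)).resolve_left hpc
          refine absurd (hp.dvd_of_dvd_pow (n := 2) ?_) hpc'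
          rw [show c' ^ 2 = 4 * p ^ k - 27 * d' ^ 2 by linarith]
          exact dvd_sub ((dvd_pow_self p hk.ne').mul_left _) ((dvd_pow h4 (by norm_num)).mul_left _)
      · exact Or.inl (((hp.coprime_iff_not_dvd.2 h2).pow_left).dvd_of_dvd_mul_right hprod)
    · exact Or.inr (((hp.coprime_iff_not_dvd.2 h1).pow_left).dvd_of_dvd_mul_left hprod)
  rcases hor with h1 | h1
  · obtain ⟨h2, h3⟩ := fin d h (cubic_representation_proportional hQ h h' h1)
    exact ⟨h2, Or.inl h3⟩
  · have h0 : 4 * p ^ k = c ^ 2 + 27 * (-d) ^ 2 := by rw [h]; ring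
    obtain ⟨h2, h3⟩ := fin (-d) h0 (cubic_representation_proportional hQ h0 h'
      (by rwa [mul_neg, sub_neg_eq_add]))
    exact ⟨h2, Or.inr h3⟩

/-! ### A central binomial coefficient modulo `p` -/

/-- No carries: `p ∤ (2k choose k)` if every base-`p` digit of `k` is `< p / 2`. -/
theorem not_dvd_choose_of_geometric {p e : ℕ} [hp : Fact p.Prime] (he : 2 * e < p) (m : ℕ) :
    ¬ p ∣ (2 * (e * ∑ i ∈ range m, p ^ i)).choose (e * ∑ i ∈ range m, p ^ i) := by
  induction m with
  | zero => simpa using hp.out.one_lt.ne'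
  | succ m ih =>
    set k := e * ∑ i ∈ range m, p ^ i with hk
    have hk' : e * ∑ i ∈ range (m + 1), p ^ i = p * k + e := by
      rw [Finset.sum_range_succ', hk]
      simp only [pow_succ, ← Finset.sum_mul]; ring
    rw [hk', show 2 * (p * k + e) = p * (2 * k) + 2 * e by ring]
    have h := Choose.choose_modEq_choose_mod_mul_choose_div_nat (n := p * (2 * k) + 2 * e)
      (k := p * k + e) (p := p)
    rw [Nat.mul_add_mod, Nat.mul_add_mod, Nat.mul_add_div hp.out.pos, Nat.mul_add_div hp.out.pos,
      Nat.mod_eq_of_lt he, Nat.mod_eq_of_lt (by omega : e < p), Nat.div_eq_of_lt he,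
      Nat.div_eq_of_lt (by omega : e < p), add_zero, add_zero] at h
    rw [h.dvd_iff dvd_rfl, hp.out.dvd_mul, not_or]
    refine ⟨fun hd => ?_, ih⟩
    have := (hp.out.dvd_factorial).1 (hd.trans ((Nat.choose_mul_factorial_mul_factorial
      (by omega : e ≤ 2 * e)) ▸ (dvd_mul_right _ _ |>.mul_right _)))
    omega

/-! ### Support size as a sum of weights -/

/-- The support of a subspace `U` and the weights of its vectors. -/
theorem sum_card_ne_zero_eq_mul_ncard_codeSupport {p : ℕ} [Fact p.Prime] {ι : Type*} [Fintype ι]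
    (U : Submodule (ZMod p) (ι → ZMod p)) [Fintype U] {r : ℕ} (hr : 1 ≤ r)
    (hU : Module.finrank (ZMod p) U = r) :
    ∑ x : U, #{i | x.1 i ≠ 0} = (p ^ r - p ^ (r - 1)) * (codeSupport U).ncard := by
  classical
  have hswap : ∑ x : U, #{i | x.1 i ≠ 0} = ∑ i, #{x : U | x.1 i ≠ 0} := by
    simp only [card_filter]
    exact sum_comm
  -- On the support the coordinate is a surjective functional on `U`, with kernel of size `p ^ (r -
  -- 1)`.
  have hi : ∀ i, #{x : U | x.1 i ≠ 0} = if i ∈ codeSupport U then p ^ r - p ^ (r - 1) else 0 := by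
    intro i
    split_ifs with h
    · let f : U →ₗ[ZMod p] ZMod p := (LinearMap.proj i).comp U.subtype
      have hf : LinearMap.range f = ⊤ := by
        obtain ⟨x, hx, hxi⟩ := h
        rw [LinearMap.range_eq_top]
        apply LinearMap.surjective
        intro h0
        exact hxi (DFunLike.congr_fun h0 ⟨x, hx⟩)
      have hker : Module.finrank (ZMod p) (LinearMap.ker f) = r - 1 := by
        have := LinearMap.finrank_range_add_finrank_ker f
        rw [hf, finrank_top, Module.finrank_self, hU] at this
        omega
      have hcU : Fintype.card U = p ^ r := by
        rw [Module.card_eq_pow_finrank (K := ZMod p), ZMod.card, hU]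
      have hck : #{x : U | x.1 i = 0} = p ^ (r - 1) := by
        have h1 := Module.card_eq_pow_finrank (K := ZMod p) (V := LinearMap.ker f)
        rw [ZMod.card, hker] at h1
        rw [← h1, ← Fintype.card_subtype]
        exact Fintype.card_congr (Equiv.refl _)
      have := card_filter_add_card_filter_not (s := (univ : Finset U)) (fun x => x.1 i = 0)
      rw [card_univ, hcU, hck] at this
      simp only [ne_eq]
      omega
    · rw [card_eq_zero, filter_eq_empty_iff]
      intro x _ hx
      exact h ⟨x.1, x.2, hx⟩
  rw [hswap, sum_congr rfl fun i _ => hi i, ← sum_filter, sum_const, smul_eq_mul, mul_comm,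
    Set.ncard_eq_toFinset_card']
  congr 2
  ext i
  simp

/-! ### Cubic characters, Gauss and Jacobi sums -/

/-- The nonzero elements `u` of a finite field with `u ^ k = 1`; when the field has `3 k + 1`
elements these are the nonzero cubes. -/
noncomputable def nonzeroCubes (F : Type*) [Field F] [Fintype F] (k : ℕ) : Finset F :=
  open Classical in {u | u ≠ 0 ∧ u ^ k = 1}

theorem mem_nonzeroCubes {F : Type*} [Field F] [Fintype F] {k : ℕ} {u : F} :
    u ∈ nonzeroCubes F k ↔ u ≠ 0 ∧ u ^ k = 1 := by
  simp [nonzeroCubes]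

/-- The sum of the values of the two cubic characters: `0` at `0`, `2` at nonzero cubes and `-1`
at noncubes. -/
noncomputable def cubicIndicator (F : Type*) [Field F] [Fintype F] (k : ℕ) (u : F) : ℤ :=
  open Classical in if u = 0 then 0 else if u ∈ nonzeroCubes F k then 2 else -1

/-- The reduced cubic Gaussian period `1 + 3 ∑ ψ (a u)`, the sum being over nonzero cubes `u`. -/
noncomputable def reducedCubicPeriod {F : Type*} [Field F] [Fintype F] (k : ℕ)
    (ψ : AddChar F ℂ) (a : F) : ℂ :=
  1 + 3 * ∑ u ∈ nonzeroCubes F k, ψ (a * u)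

theorem mulChar_pow_three_eq_one {F : Type*} [Field F] {χ : MulChar F ℂ} (h3 : χ ^ 3 = 1) {u : F} (hu : u ≠ 0) :
    χ u ^ 3 = 1 := by
  have : ((Units.mk0 u hu : Fˣ) : F) = u := rfl
  rw [← this, ← MulChar.pow_apply_coe, h3, MulChar.one_apply_coe]

section

variable {F : Type*} [Field F] [Fintype F] {k : ℕ}

theorem add_sq_of_pow_three_eq_one {R : Type*} [CommRing R] [IsDomain R] {z : R}
    (hz : z ^ 3 = 1) [Decidable (z = 1)] : z + z ^ 2 = if z = 1 then 2 else -1 := by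
  split_ifs with h
  · rw [h]; norm_num
  · have : (z - 1) * (z ^ 2 + z + 1) = 0 := by linear_combination hz
    have := (mul_eq_zero.1 this).resolve_left (sub_ne_zero.2 h)
    linear_combination this

theorem pow_pow_three_eq_one (hk : Fintype.card F = 3 * k + 1) {u : F} (hu : u ≠ 0) :
    (u ^ k) ^ 3 = 1 := by
  rw [← pow_mul, mul_comm, show 3 * k = Fintype.card F - 1 by omega]
  exact FiniteField.pow_card_sub_one_eq_one u hu

/-- The map `u ↦ u ^ k` is a cubic character with values in `F` itself. One integer-valued indicator
thus has a power expression in `F` and a character expression in `ℂ`, which lets a complex Jacobi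
sum be reduced mod `p`. -/
theorem cubicIndicator_cast_field (hk : Fintype.card F = 3 * k + 1) (u : F) :
    (cubicIndicator F k u : F) = u ^ k + u ^ (2 * k) := by
  classical
  have hk0 : k ≠ 0 := by
    rintro rfl
    have := Fintype.one_lt_card (α := F)
    omega
  unfold cubicIndicator
  by_cases hu : u = 0
  · simp [hu, hk0]
  · rw [mul_comm 2 k, pow_mul, add_sq_of_pow_three_eq_one (pow_pow_three_eq_one hk hu)]
    simp only [hu, mem_nonzeroCubes, if_false]
    split_ifs with h1 h2 h2 <;> simp_all

/-- For a generator `g` of order `3 k`, both `χ (g ^ j) = 1` and `(g ^ j) ^ k = 1` amount to `3 ∣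
j`. -/
theorem exists_cubic_mulChar (hk : Fintype.card F = 3 * k + 1) :
    ∃ χ : MulChar F ℂ, χ ^ 3 = 1 ∧ χ ≠ 1 ∧ (∀ u, u ≠ 0 → (χ u = 1 ↔ u ^ k = 1)) ∧
      ∃ g : F, g ≠ 0 ∧ χ g ≠ 1 := by
  classical
  obtain ⟨χ, hχ⟩ := MulChar.exists_mulChar_orderOf F (n := 3) (R := ℂ) (by omega)
    (Complex.isPrimitiveRoot_exp 3 (by norm_num))
  have h3 : χ ^ 3 = 1 := hχ ▸ pow_orderOf_eq_one χ
  have h1 : χ ≠ 1 := by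
    rintro rfl
    simp at hχ
  obtain ⟨g, hg⟩ := IsCyclic.exists_generator (α := Fˣ)
  have hgo : orderOf g = 3 * k := by
    rw [orderOf_eq_card_of_forall_mem_zpowers hg, Nat.card_eq_fintype_card, Fintype.card_units, hk]
    rfl
  have hcub : χ (g : F) ^ 3 = 1 := by
    rw [← MulChar.pow_apply_coe, h3, MulChar.one_apply_coe]
  have hpow : ∀ u : Fˣ, ∃ j : ℕ, g ^ j = u := fun u => by
    obtain ⟨j, -, hj⟩ := (mem_powers_iff_mem_range_orderOf (x := g) (y := u)).1
      (mem_powers_iff_mem_zpowers.2 (hg u)) |> Finset.mem_image.1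
    exact ⟨j, hj⟩
  have hg1 : χ (g : F) ≠ 1 := by
    intro h
    apply h1
    rw [MulChar.eq_one_iff]
    intro u
    obtain ⟨j, rfl⟩ := hpow u
    rw [Units.val_pow_eq_pow_val, map_pow, h, one_pow]
  have hord : orderOf (χ (g : F)) = 3 := orderOf_eq_prime hcub hg1
  refine ⟨χ, h3, h1, fun u hu => ?_, g, g.ne_zero, hg1⟩
  obtain ⟨j, hj⟩ := hpow (Units.mk0 u hu)
  have hju : u = ((g ^ j : Fˣ) : F) := by rw [hj]; rfl
  have hk0 : 0 < k := by
    have := Fintype.one_lt_card (α := F)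
    omega
  rw [hju, ← Units.val_pow_eq_pow_val, Units.val_eq_one, ← pow_mul, ← orderOf_dvd_iff_pow_eq_one,
    hgo, Nat.mul_dvd_mul_iff_right hk0, Units.val_pow_eq_pow_val, map_pow,
    ← orderOf_dvd_iff_pow_eq_one, hord]

theorem cubicIndicator_cast_complex {χ : MulChar F ℂ}
    (h3 : χ ^ 3 = 1) (hχ : ∀ u, u ≠ 0 → (χ u = 1 ↔ u ^ k = 1)) (u : F) :
    (cubicIndicator F k u : ℂ) = χ u + (χ ^ 2) u := by
  classical
  unfold cubicIndicator
  rw [MulChar.pow_apply' _ (by norm_num)]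
  by_cases hu : u = 0
  · simp [hu, MulChar.map_zero]
  · rw [add_sq_of_pow_three_eq_one (mulChar_pow_three_eq_one h3 hu)]
    simp only [hu, mem_nonzeroCubes, if_false, hχ u hu]
    split_ifs with h1 h2 h2 <;> simp_all

/-- The indicator is `[u = 0] + 3 [u a nonzero cube] - 1`, and the constant `-1` contributes nothing
because `ψ (a ·)` sums to zero. -/
theorem sum_cubicIndicator_mul {ψ : AddChar F ℂ} (hψ : ψ.IsPrimitive) {a : F} (ha : a ≠ 0) :
    ∑ u, (cubicIndicator F k u : ℂ) * ψ (a * u) = reducedCubicPeriod k ψ a := by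
  classical
  have hs : ∑ u, ψ (a * u) = 0 := by
    have := AddChar.sum_eq_zero_of_ne_one (hψ ha)
    simpa [AddChar.mulShift_apply] using this
  have hpt : ∀ u, (cubicIndicator F k u : ℂ) * ψ (a * u) =
      (if u = 0 then 1 else 0) + 3 * (if u ∈ nonzeroCubes F k then ψ (a * u) else 0)
        - ψ (a * u) := by
    intro u
    unfold cubicIndicator
    by_cases hu : u = 0
    · simp [hu, mem_nonzeroCubes]
    · simp only [hu, if_false]
      split_ifs <;> push_cast <;> ring
  rw [sum_congr rfl fun u _ => hpt u, sum_sub_distrib, sum_add_distrib, hs, ← mul_sum]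
  simp [reducedCubicPeriod]

theorem sum_pow_eq_ite (hk : Fintype.card F = 3 * k + 1) {i : ℕ} (hi : i < 6 * k) :
    ∑ x : F, x ^ i = if i = 3 * k then -1 else 0 := by
  classical
  split_ifs with h
  · have : ∀ x : F, x ^ i = 1 - if x = 0 then 1 else 0 := by
      intro x
      have hk0 : k ≠ 0 := by
        rintro rfl
        omega
      by_cases hx : x = 0
      · simp [hx, h, hk0]
      · rw [if_neg hx, h, mul_comm, pow_mul, pow_pow_three_eq_one hk hx, sub_zero]
    rw [sum_congr rfl fun x _ => this x, sum_sub_distrib]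
    simp
  · rcases lt_or_gt_of_ne h with h' | h'
    · exact FiniteField.sum_pow_lt_card_sub_one F i (by omega)
    -- Reduce the exponent by `q - 1 = 3 k`; it stays positive, so the reduction also holds at `x =
    -- 0`.
    · rw [← FiniteField.sum_pow_lt_card_sub_one F (i - 3 * k) (by omega)]
      refine sum_congr rfl fun x _ => ?_
      rw [show i = Fintype.card F + (i - 3 * k - 1) by omega, pow_add, FiniteField.pow_card,
        ← pow_succ']
      congr 1
      omega

theorem sum_mul_one_sub_pow (hk : Fintype.card F = 3 * k + 1) {n : ℕ} (hn : 2 * n < 6 * k) :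
    ∑ x : F, (x * (1 - x)) ^ n = ∑ j ∈ range (n + 1),
      (-1) ^ j * (n.choose j : F) * if n + j = 3 * k then -1 else 0 := by
  have : ∀ x : F, (x * (1 - x)) ^ n =
      ∑ j ∈ range (n + 1), (-1) ^ j * (n.choose j : F) * x ^ (n + j) := by
    intro x
    rw [mul_pow, sub_eq_neg_add, add_pow, mul_sum]
    refine sum_congr rfl fun j _ => ?_
    rw [one_pow, neg_pow, pow_add]
    ring
  rw [sum_congr rfl fun x _ => this x, sum_comm]
  refine sum_congr rfl fun j hj => ?_
  rw [← mul_sum, sum_pow_eq_ite hk]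
  rw [mem_range] at hj
  omega

/-- Only the monomial `x ^ (3 k)` has nonzero power sum here. The `k`-th power of `x (1 - x)` has
degree `2 k < 3 k`, and the `2 k`-th power contains that monomial once, at `j = k`. -/
theorem sum_cubicIndicator_cast_field (hk : Fintype.card F = 3 * k + 1) :
    ((∑ x : F, cubicIndicator F k (x * (1 - x)) : ℤ) : F) =
      (-1) ^ (k + 1) * ((2 * k).choose k : F) := by
  have hk0 : 0 < k := by
    have := Fintype.one_lt_card (α := F)
    omega
  push_cast
  rw [sum_congr rfl fun x _ => cubicIndicator_cast_field hk _, sum_add_distrib,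
    sum_mul_one_sub_pow hk (by omega), sum_mul_one_sub_pow hk (by omega),
    sum_eq_zero, sum_eq_single k]
  · rw [if_pos (by omega)]; ring
  · intro j _ hj
    rw [if_neg (by omega), mul_zero]
  · intro h
    exact absurd (mem_range.2 (by omega)) h
  · intro j hj
    rw [mem_range] at hj
    rw [if_neg (by omega), mul_zero]

/-- The reduced cubic Gaussian periods are the roots of `X³ - 3 q X - q t`, with `t` the sum of
the two cubic Jacobi sums. -/
theorem reducedCubicPeriod_cubic (hk : Fintype.card F = 3 * k + 1) {ψ : AddChar F ℂ}
    (hψ : ψ.IsPrimitive) :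
    (∀ a : F, a ≠ 0 → reducedCubicPeriod k ψ a ^ 3 = Fintype.card F *
      (3 * reducedCubicPeriod k ψ a + (∑ x : F, cubicIndicator F k (x * (1 - x)) : ℤ))) ∧
    ∃ a₀ a₁ a₂ : F, a₀ ≠ 0 ∧ a₁ ≠ 0 ∧ a₂ ≠ 0 ∧
      reducedCubicPeriod k ψ a₀ + reducedCubicPeriod k ψ a₁ + reducedCubicPeriod k ψ a₂ = 0 ∧
      reducedCubicPeriod k ψ a₀ * reducedCubicPeriod k ψ a₁ +
        reducedCubicPeriod k ψ a₀ * reducedCubicPeriod k ψ a₂ +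
        reducedCubicPeriod k ψ a₁ * reducedCubicPeriod k ψ a₂ = -(3 * Fintype.card F) ∧
      ∀ a, a ≠ 0 → reducedCubicPeriod k ψ a = reducedCubicPeriod k ψ a₀ ∨
        reducedCubicPeriod k ψ a = reducedCubicPeriod k ψ a₁ ∨
        reducedCubicPeriod k ψ a = reducedCubicPeriod k ψ a₂ := by
  obtain ⟨χ, h3, h1, hχ, g, hg, hg1⟩ := exists_cubic_mulChar hk
  have hinv : χ⁻¹ = χ ^ 2 := inv_eq_of_mul_eq_one_right (by rw [← pow_succ', h3])
  have hinv' : (χ ^ 2)⁻¹ = χ := by rw [← hinv, inv_inv]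
  have h2 : χ ^ 2 ≠ 1 := by rw [← hinv]; simpa using h1
  set G := gaussSum χ ψ with hG
  set G' := gaussSum (χ ^ 2) ψ with hG'
  -- This is Cardano's form of a root: `a` enters only through the cube root of unity `χ a`. The
  -- cubic then follows from `G G' = q`, `G³ = q J(χ, χ)` and `G'³ = q J(χ², χ²)`.
  have hperiod : ∀ a, a ≠ 0 → reducedCubicPeriod k ψ a = χ a ^ 2 * G + χ a * G' := by
    intro a ha
    have hA := gaussSum_mulShift_eq χ ψ (Units.mk0 a ha)
    have hB := gaussSum_mulShift_eq (χ ^ 2) ψ (Units.mk0 a ha)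
    rw [hinv, MulChar.pow_apply' _ (by norm_num), Units.val_mk0] at hA
    rw [hinv', Units.val_mk0] at hB
    rw [← sum_cubicIndicator_mul hψ ha, ← hA, ← hB, gaussSum, gaussSum, ← sum_add_distrib]
    refine sum_congr rfl fun u _ => ?_
    rw [cubicIndicator_cast_complex h3 hχ, AddChar.mulShift_apply]
    ring
  -- As `-1` is a cube, no sign appears in `G G' = q`.
  have hm1 : χ (-1) = 1 := by
    have := mulChar_pow_three_eq_one h3 (neg_ne_zero.2 (one_ne_zero (α := F)))
    rw [← map_pow] at this
    rwa [show (-1 : F) ^ 3 = -1 by norm_num] at this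
  have hGG : G * G' = Fintype.card F := by
    have h := gaussSum_mul_gaussSum_eq_card h1 hψ
    have h' := mul_gaussSum_inv_eq_gaussSum χ⁻¹ ψ
    rw [hinv, MulChar.pow_apply' _ (by norm_num), hm1, one_pow, one_mul] at h'
    rw [hinv, h'] at h
    exact h
  have hJ : (∑ x : F, cubicIndicator F k (x * (1 - x)) : ℤ) =
      jacobiSum χ χ + jacobiSum (χ ^ 2) (χ ^ 2) := by
    push_cast
    rw [jacobiSum, jacobiSum, ← sum_add_distrib]
    refine sum_congr rfl fun x _ => ?_
    rw [cubicIndicator_cast_complex h3 hχ, map_mul, map_mul]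
  have hJ1 : G' * jacobiSum χ χ = G ^ 2 := by
    have := jacobiSum_mul_nontrivial (χ := χ) (φ := χ) (by rwa [← sq]) ψ
    rw [← sq, ← sq] at this
    exact this
  have h4 : χ ^ 2 * χ ^ 2 = χ := by rw [← pow_add, pow_succ, h3, one_mul]
  have hJ2 : G * jacobiSum (χ ^ 2) (χ ^ 2) = G' ^ 2 := by
    have := jacobiSum_mul_nontrivial (χ := χ ^ 2) (φ := χ ^ 2) (by rwa [h4]) ψ
    rw [h4, ← sq (gaussSum _ _)] at this
    exact this
  have hw : χ g ^ 3 = 1 := mulChar_pow_three_eq_one h3 hg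
  have hroot : ∀ z : ℂ, z ^ 3 = 1 → z ≠ 1 → z ^ 2 + z + 1 = 0 := by
    intro z hz hz1
    have : (z - 1) * (z ^ 2 + z + 1) = 0 := by linear_combination hz
    exact (mul_eq_zero.1 this).resolve_left (sub_ne_zero.2 hz1)
  have hw2 := hroot _ hw hg1
  refine ⟨fun a ha => ?_, 1, g, g ^ 2, one_ne_zero, hg, pow_ne_zero _ hg, ?_, ?_, fun a ha => ?_⟩
  · have hz := mulChar_pow_three_eq_one h3 ha
    rw [hperiod a ha, hJ, ← hGG]
    linear_combination (G ^ 3 * (χ a ^ 3 + 1) + 3 * G * G' * (χ a ^ 2 * G + χ a * G') + G' ^ 3) * hz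
      - G * hJ1 - G' * hJ2
  · rw [hperiod 1 one_ne_zero, hperiod g hg, hperiod _ (pow_ne_zero _ hg), map_one, map_pow]
    linear_combination (G + G') * hw2 + G * χ g * hw
  · rw [hperiod 1 one_ne_zero, hperiod g hg, hperiod _ (pow_ne_zero _ hg), map_one, map_pow, ← hGG]
    generalize χ g = w at *
    have hw4 : w ^ 4 = w := by linear_combination w * hw
    have e : w ^ 2 = -1 - w := by linear_combination hw2
    simp only [← pow_mul]
    norm_num
    rw [hw4, e]
    ring_nf
    rw [e]
    ring
  · have hz := mulChar_pow_three_eq_one h3 ha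
    rw [hperiod a ha, hperiod 1 one_ne_zero, hperiod g hg, hperiod _ (pow_ne_zero _ hg), map_one,
      map_pow]
    by_cases hz1 : χ a = 1
    · exact Or.inl (by rw [hz1])
    · have hz2 := hroot _ hz hz1
      have : (χ a - χ g) * (χ a - χ g ^ 2) = 0 := by
        linear_combination hz2 - χ a * hw2 + hw
      rcases mul_eq_zero.1 this with h | h
      · exact Or.inr (Or.inl (by rw [sub_eq_zero.1 h]))
      · exact Or.inr (Or.inr (by rw [sub_eq_zero.1 h]))

end

/-! ### Periods of the trace character and traces of cubes -/

/-- The additive character `x ↦ exp (2 π i Tr x / p)` of a finite extension of `𝔽_p`. -/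
noncomputable def traceAddChar (p : ℕ) [NeZero p] (F : Type*) [Field F] [Algebra (ZMod p) F] :
    AddChar F ℂ :=
  (ZMod.stdAddChar (N := p)).compAddMonoidHom (Algebra.trace (ZMod p) F).toAddMonoidHom

theorem traceAddChar_apply (p : ℕ) [NeZero p] {F : Type*} [Field F] [Algebra (ZMod p) F] (x : F) :
    traceAddChar p F x = ZMod.stdAddChar (Algebra.trace (ZMod p) F x) := rfl

theorem traceAddChar_isPrimitive (p : ℕ) [Fact p.Prime] (F : Type*) [Field F] [Fintype F]
    [Algebra (ZMod p) F] : (traceAddChar p F).IsPrimitive := by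
  intro a ha h
  have : Module.Finite (ZMod p) F := Module.Finite.of_finite
  obtain ⟨x, hx⟩ := Algebra.trace_surjective (ZMod p) F 1
  have h1 := DFunLike.congr_fun h (a⁻¹ * x)
  rw [AddChar.mulShift_apply, mul_inv_cancel_left₀ ha, traceAddChar_apply, hx,
    AddChar.one_apply, ← AddChar.map_zero_eq_one (ZMod.stdAddChar (N := p)),
    ZMod.injective_stdAddChar.eq_iff] at h1
  exact one_ne_zero h1

theorem trace_algebraMap_mul {p : ℕ} {F : Type*} [Field F] [Algebra (ZMod p) F]
    (y : ZMod p) (x : F) :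
    Algebra.trace (ZMod p) F (algebraMap (ZMod p) F y * x) = y * Algebra.trace (ZMod p) F x := by
  rw [← Algebra.smul_def, map_smul, smul_eq_mul]

/-- The number of nonzero cubes `u` with `Tr (a u) = c`. -/
noncomputable def traceCubeCount {p : ℕ} {F : Type*} [Field F] [Fintype F] [Algebra (ZMod p) F]
    (k : ℕ) (a : F) (c : ZMod p) : ℕ :=
  #{u ∈ nonzeroCubes F k | Algebra.trace (ZMod p) F (a * u) = c}

section

variable {F : Type*} [Field F] [Fintype F] {k : ℕ}

theorem mul_mem_nonzeroCubes_iff {y u : F} (hy : y ∈ nonzeroCubes F k) :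
    y * u ∈ nonzeroCubes F k ↔ u ∈ nonzeroCubes F k := by
  rw [mem_nonzeroCubes] at hy
  simp [mem_nonzeroCubes, mul_pow, hy.1, hy.2]

theorem sum_nonzeroCubes_mul {M : Type*} [AddCommMonoid M] {y : F} (hy : y ∈ nonzeroCubes F k)
    (f : F → M) : ∑ u ∈ nonzeroCubes F k, f (y * u) = ∑ u ∈ nonzeroCubes F k, f u := by
  have hy0 := (mem_nonzeroCubes.1 hy).1
  refine sum_bij' (fun u _ => y * u) (fun u _ => y⁻¹ * u)
    (fun u hu => (mul_mem_nonzeroCubes_iff hy).2 hu) (fun u hu => ?_) ?_ ?_ fun _ _ => rfl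
  · rw [← mul_mem_nonzeroCubes_iff hy, mul_inv_cancel_left₀ hy0]
    exact hu
  · intro u _
    exact inv_mul_cancel_left₀ hy0 u
  · intro u _
    exact mul_inv_cancel_left₀ hy0 u

theorem reducedCubicPeriod_mul (ψ : AddChar F ℂ) {y : F} (hy : y ∈ nonzeroCubes F k) (a : F) :
    reducedCubicPeriod k ψ (a * y) = reducedCubicPeriod k ψ a := by
  unfold reducedCubicPeriod
  rw [← sum_nonzeroCubes_mul hy fun u => ψ (a * u)]
  simp only [mul_assoc]

theorem card_nonzeroCubes (hk : Fintype.card F = 3 * k + 1) : #(nonzeroCubes F k) = k := by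
  classical
  obtain ⟨χ, h3, h1, hχ, g, hg, hg1⟩ := exists_cubic_mulChar hk
  have h2 : χ ^ 2 ≠ 1 := by
    intro h
    exact h1 (by rw [← h3, pow_succ, h, one_mul])
  have hs : (∑ u, cubicIndicator F k u : ℤ) = 0 := by
    have : ((∑ u, cubicIndicator F k u : ℤ) : ℂ) = 0 := by
      push_cast
      rw [sum_congr rfl fun u _ => cubicIndicator_cast_complex h3 hχ u, sum_add_distrib,
        MulChar.sum_eq_zero_of_ne_one h1, MulChar.sum_eq_zero_of_ne_one h2, add_zero]
    exact_mod_cast this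
  have hpt : ∀ u : F, cubicIndicator F k u =
      (if u = 0 then 1 else 0) + 3 * (if u ∈ nonzeroCubes F k then 1 else 0) - 1 := by
    intro u
    unfold cubicIndicator
    by_cases hu : u = 0
    · simp [hu, mem_nonzeroCubes]
    · simp only [hu, if_false]
      split_ifs <;> norm_num
  rw [sum_congr rfl fun u _ => hpt u, sum_sub_distrib, sum_add_distrib, ← mul_sum] at hs
  simp [hk] at hs
  omega

variable {p : ℕ} [Fact p.Prime] [Algebra (ZMod p) F]

theorem algebraMap_mem_nonzeroCubes (hpk : p - 1 ∣ k) {y : ZMod p} (hy : y ≠ 0) :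
    algebraMap (ZMod p) F y ∈ nonzeroCubes F k := by
  obtain ⟨l, rfl⟩ := hpk
  rw [mem_nonzeroCubes, ← map_pow, pow_mul, ZMod.pow_card_sub_one_eq_one hy, one_pow, map_one]
  exact ⟨by simpa using hy, rfl⟩

/-- Scaling by `𝔽_pˣ`, which consists of cubes, permutes the nonzero trace values. -/
theorem traceCubeCount_eq_one (hpk : p - 1 ∣ k) (a : F) {c : ZMod p} (hc : c ≠ 0) :
    traceCubeCount k a c = traceCubeCount k a (1 : ZMod p) := by
  unfold traceCubeCount
  rw [card_filter, card_filter, ← sum_nonzeroCubes_mul (algebraMap_mem_nonzeroCubes hpk hc)]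
  refine sum_congr rfl fun u _ => ?_
  rw [mul_left_comm, trace_algebraMap_mul]
  simp only [mul_eq_left₀ hc]

/-- The reduced cubic period of the trace character is an integer `≡ 1 (mod 3)`, which determines
the number of nonzero cubes `u` with `Tr (a u) = 0`. -/
theorem exists_int_reducedCubicPeriod (hk : Fintype.card F = 3 * k + 1) (hpk : p - 1 ∣ k) (a : F) :
    ∃ A : ℤ, A ≡ 1 [ZMOD 3] ∧ (A : ℂ) = reducedCubicPeriod k (traceAddChar p F) a ∧
      3 * (p : ℤ) * traceCubeCount k a (0 : ZMod p) = 3 * k + (p - 1) * (A - 1) := by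
  classical
  set E₀ := traceCubeCount k a (0 : ZMod p) with hE₀
  set E₁ := traceCubeCount k a (1 : ZMod p)
  have hE : ∀ c : ZMod p, (traceCubeCount k a c : ℤ) = (if c = 0 then (E₀ : ℤ) - E₁ else 0) + E₁ := by
    intro c
    by_cases hc : c = 0
    · simp [hc, hE₀]
    · rw [traceCubeCount_eq_one hpk a hc, if_neg hc, zero_add]
  have hψ0 : ∑ c : ZMod p, (ZMod.stdAddChar c : ℂ) = 0 := by
    have := AddChar.sum_eq_zero_of_ne_one
      (ZMod.isPrimitive_stdAddChar p (one_ne_zero (α := ZMod p)))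
    simpa [AddChar.mulShift_apply] using this
  -- All nonzero traces occur equally often and the nontrivial `p`-th roots of unity sum to `-1`.
  have hsum : ∑ u ∈ nonzeroCubes F k, traceAddChar p F (a * u) = ((E₀ - E₁ : ℤ) : ℂ) := by
    rw [← sum_fiberwise _ fun u => Algebra.trace (ZMod p) F (a * u)]
    have : ∀ c : ZMod p, ∑ u ∈ nonzeroCubes F k with Algebra.trace (ZMod p) F (a * u) = c,
        traceAddChar p F (a * u) = ((if c = 0 then (E₀ : ℤ) - E₁ else 0 : ℤ) : ℂ) +
          E₁ * ZMod.stdAddChar c := by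
      intro c
      rw [sum_congr rfl (g := fun _ => (ZMod.stdAddChar c : ℂ)), sum_const, nsmul_eq_mul]
      · have := congrArg (fun z : ℤ => (z : ℂ)) (hE c)
        unfold traceCubeCount at this
        push_cast at this ⊢
        rw [this]
        by_cases hc : c = 0
        · simp [hc]
        · simp [hc]
      · intro u hu
        rw [traceAddChar_apply, (mem_filter.1 hu).2]
    rw [sum_congr rfl fun c _ => this c, sum_add_distrib, ← mul_sum, hψ0, mul_zero, add_zero]
    push_cast
    simp
  refine ⟨1 + 3 * (E₀ - E₁), ?_, ?_, ?_⟩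
  · rw [Int.modEq_iff_dvd]
    omega
  · rw [reducedCubicPeriod, hsum]
    push_cast
    ring
  · have hcard : (k : ℤ) = E₀ - E₁ + p * E₁ := by
      have h := card_eq_sum_card_fiberwise (s := nonzeroCubes F k) (t := univ)
        (f := fun u => Algebra.trace (ZMod p) F (a * u)) (by simp [Set.MapsTo])
      rw [card_nonzeroCubes hk] at h
      have h' : (k : ℤ) = ∑ c : ZMod p, (traceCubeCount k a c : ℤ) := by
        exact_mod_cast h
      rw [h', sum_congr rfl fun c _ => hE c, sum_add_distrib]
      simp
    rw [hcard]
    ring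

end

/-! ### From `N`-th powers to cubes: codeword weights -/

/-- The sum of `f ∘ φ` over a group is a multiple of the sum of `f` over the range of `φ`. -/
theorem card_range_mul_sum_comp {G K : Type*} [Group G] [Fintype G] [Group K] [DecidableEq K]
    (φ : G →* K) (S : Finset K) (hS : ∀ u, u ∈ S ↔ u ∈ φ.range) (f : K → ℕ) :
    #S * ∑ g, f (φ g) = Fintype.card G * ∑ u ∈ S, f u := by
  have hfib : ∀ u ∈ S, #{g | φ g = u} = #{g | φ g = 1} := fun u hu =>
    MonoidHom.card_fiber_eq_of_mem_range φ ((hS u).1 hu) ⟨1, map_one φ⟩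
  have hmap : ∀ g ∈ (univ : Finset G), φ g ∈ S := fun g _ => (hS _).2 ⟨g, rfl⟩
  have h1 : Fintype.card G = #S * #{g | φ g = 1} := by
    rw [← card_univ, card_eq_sum_card_fiberwise hmap, sum_congr rfl hfib, sum_const, smul_eq_mul]
  have h2 : ∑ g, f (φ g) = #{g | φ g = 1} * ∑ u ∈ S, f u := by
    rw [← sum_fiberwise_of_maps_to hmap, mul_sum]
    refine sum_congr rfl fun u hu => ?_
    rw [sum_congr rfl (g := fun _ => f u) fun g hg => by rw [(mem_filter.1 hg).2], sum_const,
      smul_eq_mul, hfib u hu]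
  rw [h1, h2, mul_assoc]

theorem sum_range_mul_of_periodic {f : ℕ → ℕ} {n : ℕ} (hf : ∀ j, f (j + n) = f j) (c : ℕ) :
    ∑ j ∈ range (c * n), f j = c * ∑ j ∈ range n, f j := by
  have hf' : ∀ c j, f (c * n + j) = f j := by
    intro c
    induction c with
    | zero => simp
    | succ c ih => intro j; rw [← ih j, ← hf (c * n + j)]; congr 1; ring
  induction c with
  | zero => simp
  | succ c ih =>
    rw [Nat.succ_mul, sum_range_add, ih, sum_congr rfl fun j _ => hf' c j, Nat.succ_mul]

theorem sum_units_eq_sum_range {G : Type*} [Group G] [Fintype G] {α : G}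
    (hα : ∀ x, x ∈ Subgroup.zpowers α) (f : G → ℕ) :
    ∑ x, f x = ∑ j ∈ range (Fintype.card G), f (α ^ j) := by
  classical
  have ho : orderOf α = Fintype.card G := by
    rw [orderOf_eq_card_of_forall_mem_zpowers hα, Nat.card_eq_fintype_card]
  have himg : (univ : Finset G) = (range (Fintype.card G)).image fun j => α ^ j := by
    ext x
    rw [← ho, ← mem_powers_iff_mem_range_orderOf, mem_powers_iff_mem_zpowers]
    simp [hα x]
  rw [himg, sum_image]
  rw [← ho]
  exact pow_injOn_Iio_orderOf.mono (by simp)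

section

variable {F : Type*} [Field F] [Fintype F] {k : ℕ} {p : ℕ} [Fact p.Prime] [Algebra (ZMod p) F]

/-- By Bézout `3 = N a + L b` with `L = (q - 1) / (p - 1)`. Hence `g ^ (3 i)` is an `N`-th power
times an `L`-th power, and `L`-th powers are norms to `𝔽_p`. -/
theorem exists_smul_pow_eq_of_mem_nonzeroCubes (hk : Fintype.card F = 3 * k + 1) {N : ℕ}
    (hN : Nat.gcd N ((Fintype.card F - 1) / (p - 1)) = 3) {u : Fˣ}
    (hu : (u : F) ∈ nonzeroCubes F k) :
    ∃ (y : (ZMod p)ˣ) (x : Fˣ), Units.map (algebraMap (ZMod p) F).toMonoidHom y * x ^ N = u := by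
  classical
  obtain ⟨g, hg⟩ := IsCyclic.exists_generator (α := Fˣ)
  have hgo : orderOf g = 3 * k := by
    rw [orderOf_eq_card_of_forall_mem_zpowers hg, Nat.card_eq_fintype_card, Fintype.card_units, hk]
    rfl
  have hk0 : 0 < k := by
    have := Fintype.one_lt_card (α := F)
    omega
  have huk : u ^ k = 1 := by
    have := (mem_nonzeroCubes.1 hu).2
    rwa [← Units.val_pow_eq_pow_val, Units.val_eq_one] at this
  obtain ⟨j, rfl⟩ := Subgroup.mem_zpowers_iff.1 (hg u)
  have hj : (3 : ℤ) ∣ j := by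
    rw [← zpow_natCast, ← zpow_mul, ← orderOf_dvd_iff_zpow_eq_one, hgo] at huk
    push_cast at huk
    exact (mul_dvd_mul_iff_right (by exact_mod_cast hk0.ne')).1 huk
  obtain ⟨i, rfl⟩ := hj
  set L := (Fintype.card F - 1) / (p - 1) with hL
  have hbez := Nat.gcd_eq_gcd_ab N L
  rw [hN] at hbez
  set a := Nat.gcdA N L
  set b := Nat.gcdB N L
  refine ⟨Units.map (Algebra.norm (ZMod p)) (g ^ (i * b)), g ^ (i * a), ?_⟩
  have hnorm : Units.map (algebraMap (ZMod p) F).toMonoidHom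
      (Units.map (Algebra.norm (ZMod p)) (g ^ (i * b))) = (g ^ (i * b)) ^ L := by
    ext
    have := FiniteField.algebraMap_norm_eq_pow (K := ZMod p) (x := ((g ^ (i * b) : Fˣ) : F))
    rw [Nat.card_zmod, Nat.card_eq_fintype_card, ← hL] at this
    exact this
  rw [hnorm, ← zpow_natCast, ← zpow_natCast, ← zpow_mul, ← zpow_mul, ← zpow_add]
  congr 1
  push_cast at hbez
  rw [hbez]
  ring

/-- Averages over `N`-th powers agree with averages over cubes, for functions invariant under
`𝔽_pˣ`. -/
theorem sum_units_pow_eq [DecidableEq F] (hk : Fintype.card F = 3 * k + 1) (hpk : p - 1 ∣ k) {N : ℕ}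
    (hN : Nat.gcd N ((Fintype.card F - 1) / (p - 1)) = 3) (f : F → ℕ)
    (hf : ∀ (y : ZMod p) (u : F), y ≠ 0 → f (algebraMap (ZMod p) F y * u) = f u) :
    ∑ x : Fˣ, f ((x : F) ^ N) = 3 * ∑ u ∈ nonzeroCubes F k, f u := by
  have hk0 : 0 < k := by
    have := Fintype.one_lt_card (α := F)
    omega
  let φ : (ZMod p)ˣ × Fˣ →* Fˣ :=
    (Units.map (algebraMap (ZMod p) F).toMonoidHom).coprod (powMonoidHom N)
  have hφ : ∀ y x, φ (y, x) = Units.map (algebraMap (ZMod p) F).toMonoidHom y * x ^ N :=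
    fun _ _ => rfl
  let S : Finset Fˣ := {u | (u : F) ∈ nonzeroCubes F k}
  have hS : ∀ u, u ∈ S ↔ u ∈ φ.range := by
    intro u
    simp only [S, mem_filter, mem_univ, true_and, MonoidHom.mem_range, Prod.exists, hφ]
    refine ⟨exists_smul_pow_eq_of_mem_nonzeroCubes hk hN, ?_⟩
    rintro ⟨y, x, rfl⟩
    change algebraMap (ZMod p) F y * ((x ^ N : Fˣ) : F) ∈ _
    rw [mul_mem_nonzeroCubes_iff (algebraMap_mem_nonzeroCubes hpk y.ne_zero),
      mem_nonzeroCubes]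
    refine ⟨Units.ne_zero _, ?_⟩
    obtain ⟨c, hc⟩ := hN ▸ Nat.gcd_dvd_left N ((Fintype.card F - 1) / (p - 1))
    rw [Units.val_pow_eq_pow_val, ← pow_mul, hc, show 3 * c * k = k * 3 * c by ring, pow_mul,
      pow_mul, pow_pow_three_eq_one hk x.ne_zero, one_pow]
  have hSsum : ∀ h : F → ℕ, ∑ u ∈ S, h u = ∑ u ∈ nonzeroCubes F k, h u := by
    intro h
    refine sum_bij (fun u _ => (u : F)) (fun u hu => (mem_filter.1 hu).2)
      (fun u _ v _ => Units.ext) (fun u hu => ?_) fun _ _ => rfl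
    exact ⟨Units.mk0 u (mem_nonzeroCubes.1 hu).1, mem_filter.2 ⟨mem_univ _, hu⟩, rfl⟩
  have hScard : #S = k := by
    have := hSsum fun _ => 1
    simpa [card_nonzeroCubes hk] using this
  have key := card_range_mul_sum_comp φ S hS fun u => f u
  rw [hScard, hSsum, Fintype.card_prod, Fintype.card_units (α := F), hk, Fintype.sum_prod_type,
    sum_congr rfl (g := fun _ => ∑ x : Fˣ, f ((x : F) ^ N)) (fun y _ => sum_congr rfl
      fun x _ => by rw [hφ]; exact hf _ _ y.ne_zero), sum_const, card_univ, smul_eq_mul] at key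
  have hc0 : 0 < Fintype.card (ZMod p)ˣ := Fintype.card_pos
  refine Nat.eq_of_mul_eq_mul_left (Nat.mul_pos hk0 hc0) ?_
  rw [add_tsub_cancel_right] at key
  linarith

/-- The weight of the codeword attached to `a` in terms of the reduced cubic period. -/
theorem card_traceCodeword_ne_zero (hk : Fintype.card F = 3 * k + 1) (hpk : p - 1 ∣ k) {N n : ℕ}
    (hN : Nat.gcd N ((Fintype.card F - 1) / (p - 1)) = 3) (hNn : N * n = 3 * k)
    {α : Fˣ} (hα : ∀ x, x ∈ Subgroup.zpowers α) {a : F} {A : ℤ}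
    (hA : (A : ℂ) = reducedCubicPeriod k (traceAddChar p F) a) :
    (p : ℤ) * N * #{i | traceCodeword p (fun i : Fin n => ((α ^ N : Fˣ) : F) ^ (i : ℕ)) a i ≠ 0} =
      (p - 1) * (Fintype.card F - A) := by
  classical
  obtain ⟨A', -, hA', hcount⟩ := exists_int_reducedCubicPeriod hk hpk a
  obtain rfl : A' = A := by
    rw [← hA] at hA'
    exact_mod_cast hA'
  have hcard : Fintype.card Fˣ = N * n := by
    rw [Fintype.card_units, hk, hNn]
    rfl
  let f : F → ℕ := fun u => if Algebra.trace (ZMod p) F (a * u) = 0 then 1 else 0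
  have hf : ∀ (y : ZMod p) (u : F), y ≠ 0 → f (algebraMap (ZMod p) F y * u) = f u := by
    intro y u hy
    simp only [f, mul_left_comm a, trace_algebraMap_mul, mul_eq_zero, hy, false_or]
  -- Since `N n = q - 1`, a sum over `Fˣ` runs `N` times through the coordinates of the code.
  have hper : ∀ j, f (((α ^ (j + n) : Fˣ) : F) ^ N) = f (((α ^ j : Fˣ) : F) ^ N) := by
    intro j
    rw [← Units.val_pow_eq_pow_val, ← Units.val_pow_eq_pow_val, pow_add, mul_pow, ← pow_mul α n,
      mul_comm n, ← hcard, pow_card_eq_one, mul_one]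
  have h1 := sum_units_pow_eq hk hpk hN f hf
  rw [sum_units_eq_sum_range hα fun x => f ((x : F) ^ N), hcard,
    sum_range_mul_of_periodic (f := fun j => f (((α ^ j : Fˣ) : F) ^ N)) hper] at h1
  have h2 : ∑ j ∈ range n, f (((α ^ j : Fˣ) : F) ^ N) =
      #{i | traceCodeword p (fun i : Fin n => ((α ^ N : Fˣ) : F) ^ (i : ℕ)) a i = 0} := by
    rw [← Fin.sum_univ_eq_sum_range (fun j => f (((α ^ j : Fˣ) : F) ^ N)), card_filter]
    refine sum_congr rfl fun i _ => ?_
    have hcomm : ((α ^ (i : ℕ) : Fˣ) : F) ^ N = ((α ^ N : Fˣ) : F) ^ (i : ℕ) := by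
      rw [Units.val_pow_eq_pow_val, Units.val_pow_eq_pow_val, pow_right_comm]
    simp only [f, hcomm]
    rfl
  have h3 : ∑ u ∈ nonzeroCubes F k, f u = traceCubeCount k a (0 : ZMod p) := by
    rw [traceCubeCount, card_filter]
  have h4 := card_filter_add_card_filter_not (s := (univ : Finset (Fin n)))
    (fun i => traceCodeword p (fun i : Fin n => ((α ^ N : Fˣ) : F) ^ (i : ℕ)) a i = 0)
  rw [card_univ, Fintype.card_fin] at h4
  rw [h2, h3] at h1
  simp only [ne_eq]
  set z := #{i | traceCodeword p (fun i : Fin n => ((α ^ N : Fˣ) : F) ^ (i : ℕ)) a i = 0}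
  set w := #{i | ¬ traceCodeword p (fun i : Fin n => ((α ^ N : Fˣ) : F) ^ (i : ℕ)) a i = 0}
  zify at h1 h4 hNn hk
  rw [hk]
  linear_combination (p : ℤ) * N * h4 + p * hNn - p * h1 - hcount

end

/-! ### Generalized Hamming weights -/

/-- If all nonzero codewords have weight at least `w`, and all nonzero vectors of some
`r`-dimensional subcode have weight `w`, this determines the `r`-th generalized Hamming weight. -/
theorem mul_generalizedHammingWeight_eq {p : ℕ} [Fact p.Prime] {ι : Type*} [Fintype ι]
    {C U : Submodule (ZMod p) (ι → ZMod p)} {r w : ℕ} (hr : 1 ≤ r)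
    (hC : ∀ x ∈ C, x ≠ 0 → w ≤ #{i | x i ≠ 0}) (hUC : U ≤ C)
    (hU : Module.finrank (ZMod p) U = r) (hUw : ∀ x ∈ U, x ≠ 0 → #{i | x i ≠ 0} = w) :
    (p ^ r - p ^ (r - 1)) * generalizedHammingWeight C r = (p ^ r - 1) * w := by
  classical
  have hp := (Fact.out : p.Prime)
  have hcard : ∀ V : Submodule (ZMod p) (ι → ZMod p), Module.finrank (ZMod p) V = r →
      #((univ : Finset V).erase 0) = p ^ r - 1 := by
    intro V hV
    rw [card_erase_of_mem (mem_univ _), card_univ, Module.card_eq_pow_finrank (K := ZMod p),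
      ZMod.card, hV]
  have hsum : ∀ V : Submodule (ZMod p) (ι → ZMod p), Module.finrank (ZMod p) V = r →
      ∑ x ∈ (univ : Finset V).erase 0, #{i | x.1 i ≠ 0} =
        (p ^ r - p ^ (r - 1)) * (codeSupport V).ncard := by
    intro V hV
    rw [← sum_card_ne_zero_eq_mul_ncard_codeSupport V hr hV, sum_erase]
    simp
  have hpos : 0 < p ^ r - p ^ (r - 1) :=
    Nat.sub_pos_of_lt (Nat.pow_lt_pow_right hp.one_lt (by omega))
  have hUeq : (p ^ r - p ^ (r - 1)) * (codeSupport U).ncard = (p ^ r - 1) * w := by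
    rw [← hsum U hU, ← hcard U hU, ← smul_eq_mul, ← sum_const]
    refine sum_congr rfl fun x hx => hUw x.1 x.2 fun h => (mem_erase.1 hx).1 (Subtype.ext h)
  rw [← hUeq]
  congr 1
  refine IsLeast.csInf_eq ⟨⟨U, hUC, hU, rfl⟩, ?_⟩
  rintro s ⟨V, hVC, hV, rfl⟩
  refine Nat.le_of_mul_le_mul_left ?_ hpos
  rw [hUeq, ← hsum V hV, ← hcard V hV, ← smul_eq_mul, ← sum_const]
  exact sum_le_sum fun x hx => hC x.1 (hVC x.2) fun h => (mem_erase.1 hx).1 (Subtype.ext h)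

/-- Subspaces of a subfield: if `l ∣ m` and `r ≤ l`, then `𝔽_{p^m}` has an `r`-dimensional
subspace all of whose nonzero elements lie in `𝔽_{p^l}`. -/
theorem exists_submodule_pow_eq_one {p m l r : ℕ} [Fact p.Prime] {F : Type*} [Field F] [Fintype F]
    [Algebra (ZMod p) F] (hF : Fintype.card F = p ^ m) (hl : l ≠ 0) (hlm : l ∣ m) (hr : r ≤ l) :
    ∃ K : Submodule (ZMod p) F, Module.finrank (ZMod p) K = r ∧
      ∀ x ∈ K, x ≠ 0 → x ^ (p ^ l - 1) = 1 := by
  have hm : Module.finrank (ZMod p) F = m :=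
    Nat.pow_right_injective (Fact.out : p.Prime).two_le
      ((FiniteField.pow_finrank_eq_card p F).trans hF)
  have : Fintype (GaloisField p l) := Fintype.ofFinite _
  obtain ⟨f⟩ := FiniteField.nonempty_algHom_of_finrank_dvd (F := ZMod p) (K := GaloisField p l)
    (L := F) (by rwa [GaloisField.finrank p hl, hm])
  obtain ⟨v, hv⟩ := exists_linearIndependent_of_le_finrank (R := ZMod p) (M := GaloisField p l)
    (n := r) (by rwa [GaloisField.finrank p hl])
  refine ⟨(Submodule.span (ZMod p) (Set.range v)).map f.toLinearMap, ?_, ?_⟩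
  · rw [← (Submodule.equivMapOfInjective f.toLinearMap f.toRingHom.injective _).finrank_eq,
      finrank_span_eq_card hv, Fintype.card_fin]
  · rintro _ ⟨x, -, rfl⟩ hx
    have hx0 : x ≠ 0 := by
      rintro rfl
      simp at hx
    have := FiniteField.pow_card_sub_one_eq_one x hx0
    rw [Fintype.card_eq_nat_card, GaloisField.card p l hl] at this
    rw [AlgHom.toLinearMap_apply, ← map_pow, this, map_one]

/-- The generalized Hamming weights of the code attached to a subgroup `⟨α ^ N⟩`, in terms of the
largest reduced cubic Gaussian period `A a₀`. -/
theorem generalizedHammingWeight_traceCode_eq {p k l r n N : ℕ} [Fact p.Prime]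
    {F : Type*} [Field F] [Fintype F] [Algebra (ZMod p) F]
    (hF : Fintype.card F = p ^ (3 * l)) (hk : Fintype.card F = 3 * k + 1) (hpk : p - 1 ∣ k)
    (hp : p ≡ 1 [MOD 3]) (hr : 1 ≤ r) (hrl : r ≤ l)
    (hN : Nat.gcd N ((Fintype.card F - 1) / (p - 1)) = 3) (hNn : N * n = 3 * k)
    {α : Fˣ} (hα : ∀ x, x ∈ Subgroup.zpowers α) {A : F → ℤ}
    (hA : ∀ a, (A a : ℂ) = reducedCubicPeriod k (traceAddChar p F) a)
    (hAne : ∀ a, a ≠ 0 → A a ≠ p ^ (3 * l)) {a₀ : F} (ha₀ : a₀ ≠ 0)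
    (hmax : ∀ a, a ≠ 0 → A a ≤ A a₀) :
    (generalizedHammingWeight
        (traceCode p fun i : Fin n => ((α ^ N : Fˣ) : F) ^ (i : ℕ)) r : ℝ) =
      (1 - 1 / (p : ℝ) ^ r) * (((p : ℝ) ^ (3 * l) - A a₀) / N) := by
  have hp' := (Fact.out : p.Prime)
  have hN0 : 0 < N := Nat.pos_of_ne_zero (by
    rintro rfl
    have := Fintype.one_lt_card (α := F)
    omega)
  have hp1 : (1 : ℤ) < p := by exact_mod_cast hp'.one_lt
  have hpN : (0 : ℤ) < p * N := by positivity
  set c := traceCodeword p (fun i : Fin n => ((α ^ N : Fˣ) : F) ^ (i : ℕ))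
  have hwt : ∀ a, (p : ℤ) * N * #{i | c a i ≠ 0} = (p - 1) * (p ^ (3 * l) - A a) := by
    intro a
    rw [card_traceCodeword_ne_zero hk hpk hN hNn hα (hA a), hF]
    push_cast
    rfl
  -- A zero codeword would force `A a = q`, excluded by `hAne`.
  have hinj : Function.Injective c := by
    rw [← LinearMap.ker_eq_bot, LinearMap.ker_eq_bot']
    intro a ha
    by_contra ha0
    have h := hwt a
    rw [ha] at h
    simp only [Pi.zero_apply, ne_eq, not_true_eq_false, filter_false, card_empty, Nat.cast_zero,
      mul_zero] at h
    exact hAne a ha0 (by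
      have := (mul_eq_zero.1 h.symm).resolve_left (by omega)
      linarith)
  obtain ⟨K, hKr, hK⟩ := exists_submodule_pow_eq_one hF (by omega : l ≠ 0) (dvd_mul_left l 3) hrl
  have hcube : ∀ x ∈ K, x ≠ 0 → x ∈ nonzeroCubes F k := by
    intro x hx hx0
    refine mem_nonzeroCubes.2 ⟨hx0, ?_⟩
    -- From `3 k = (p ^ l - 1) (p ^ (2 l) + p ^ l + 1)`, whose second factor is divisible by 3 as `p
    -- ≡ 1 (mod 3)`.
    have hdvd : p ^ l - 1 ∣ k := by
      have h3 : 3 ∣ (p ^ l) ^ 2 + p ^ l + 1 := by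
        have h1 : p ^ l ≡ 1 [MOD 3] := by simpa using hp.pow l
        have : (p ^ l) ^ 2 + p ^ l + 1 ≡ 1 ^ 2 + 1 + 1 [MOD 3] := ((h1.pow 2).add h1).add_right 1
        exact (this.dvd_iff dvd_rfl).2 (by norm_num)
      obtain ⟨j, hj⟩ := h3
      refine ⟨j, ?_⟩
      obtain ⟨y, hy⟩ : ∃ y, p ^ l = y + 1 :=
        ⟨p ^ l - 1, (Nat.sub_add_cancel (Nat.one_le_pow _ _ hp'.pos)).symm⟩
      rw [hF, mul_comm, pow_mul, hy] at hk
      rw [hy] at hj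
      rw [hy, Nat.add_sub_cancel]
      have : 3 * k = y * (3 * j) := by rw [← hj]; linarith
      linarith
    obtain ⟨j, rfl⟩ := hdvd
    rw [pow_mul, hK x hx hx0, one_pow]
  have hAK : ∀ x ∈ K, x ≠ 0 → A (a₀ * x) = A a₀ := by
    intro x hx hx0
    have : (A (a₀ * x) : ℂ) = A a₀ := by
      rw [hA, hA, reducedCubicPeriod_mul _ (hcube x hx hx0)]
    exact_mod_cast this
  let f : F →ₗ[ZMod p] (Fin n → ZMod p) := c.comp (LinearMap.mulLeft (ZMod p) a₀)
  have hf : Function.Injective f := hinj.comp (mul_right_injective₀ ha₀)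
  have key := mul_generalizedHammingWeight_eq (C := LinearMap.range c) (U := K.map f)
    (w := #{i | c a₀ i ≠ 0}) (r := r) hr
    (by
      rintro _ ⟨a, rfl⟩ hx
      have ha : a ≠ 0 := by
        rintro rfl
        simp at hx
      have h1 := hwt a
      have h2 := hwt a₀
      have h3 : (p - 1 : ℤ) * (p ^ (3 * l) - A a₀) ≤ (p - 1) * (p ^ (3 * l) - A a) :=
        mul_le_mul_of_nonneg_left (by linarith [hmax a ha]) (by omega)
      rw [← h1, ← h2] at h3
      exact_mod_cast le_of_mul_le_mul_left h3 hpN)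
    (by
      rintro _ ⟨x, -, rfl⟩
      exact ⟨a₀ * x, rfl⟩)
    ((Submodule.equivMapOfInjective f hf K).finrank_eq.symm.trans hKr)
    (by
      rintro _ ⟨x, hx, rfl⟩ hfx0
      have hx0 : x ≠ 0 := by
        rintro rfl
        simp at hfx0
      have h1 := hwt (a₀ * x)
      rw [hAK x hx hx0, ← hwt a₀] at h1
      exact_mod_cast mul_left_cancel₀ hpN.ne' h1)
  have hw : (p : ℝ) * N * #{i | c a₀ i ≠ 0} = (p - 1) * (p ^ (3 * l) - A a₀) := by
    exact_mod_cast hwt a₀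
  obtain ⟨s, rfl⟩ : ∃ s, r = s + 1 := ⟨r - 1, by omega⟩
  have hps : p ^ s ≤ p ^ (s + 1) := Nat.pow_le_pow_right hp'.pos (by omega)
  have key' : ((p : ℝ) ^ (s + 1) - p ^ s) * generalizedHammingWeight
      (traceCode p fun i : Fin n => ((α ^ N : Fˣ) : F) ^ (i : ℕ)) (s + 1) =
      (p ^ (s + 1) - 1) * #{i | c a₀ i ≠ 0} := by
    have := congrArg (Nat.cast (R := ℝ)) key
    rw [Nat.cast_mul, Nat.cast_mul, Nat.add_sub_cancel, Nat.cast_sub hps,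
      Nat.cast_sub (Nat.one_le_pow _ _ hp'.pos)] at this
    push_cast at this
    exact this
  have hpR : (1 : ℝ) < p := by exact_mod_cast hp'.one_lt
  have hNR : (0 : ℝ) < N := by exact_mod_cast hN0
  have hps0 : (0 : ℝ) < p ^ s := by positivity
  have hne : (p : ℝ) * N * ((p : ℝ) ^ (s + 1) - p ^ s) ≠ 0 := by
    rw [pow_succ, show (p : ℝ) ^ s * p - p ^ s = p ^ s * (p - 1) by ring]
    have : (p : ℝ) - 1 ≠ 0 := by linarith
    positivity
  refine mul_left_cancel₀ hne ?_
  rw [mul_assoc, key', mul_left_comm, hw]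
  field_simp
  ring

/-! ### The three period values and the final formula -/

theorem mainTheorem8 (p m n₁ N r : ℕ) [Fact p.Prime] (hp_odd : Odd p)
    (hn₁ : 0 < n₁) (hcop : Nat.Coprime n₁ p)
    (hm : IsLeast {k : ℕ | 0 < k ∧ p ^ k ≡ 1 [MOD n₁]} m)
    (F : Type*) [Field F] [Fintype F] [Algebra (ZMod p) F] (hF : Fintype.card F = p ^ m)
    (α : Fˣ) (hα : ∀ x : Fˣ, x ∈ Subgroup.zpowers α)
    (hN : N = (p ^ m - 1) / n₁)
    (hN₁ : Nat.gcd N ((p ^ m - 1) / (p - 1)) = 3)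
    (hp : p ≡ 1 [MOD 3]) (hr : 1 ≤ r) (hrm : (r : ℝ) ≤ (m : ℝ) / 3) :
    3 ∣ m ∧
    ∃ c₁ d₁ : ℤ, IsCubicPair p m c₁ d₁ ∧
      (∀ c d : ℤ, IsCubicPair p m c d → c = c₁ ∧ (d = d₁ ∨ d = -d₁)) ∧
      (3 * |d₁| < c₁ →
        (generalizedHammingWeight
            (traceCode p fun i : Fin n₁ => ((α ^ N : Fˣ) : F) ^ (i : ℕ)) r : ℝ) =
          (1 - 1 / (p : ℝ) ^ r) *
            (((p : ℝ) ^ m - (c₁ : ℝ) * ((p : ℝ) ^ m) ^ (1 / 3 : ℝ)) / (N : ℝ))) ∧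
      (c₁ < 3 * |d₁| →
        (generalizedHammingWeight
            (traceCode p fun i : Fin n₁ => ((α ^ N : Fˣ) : F) ^ (i : ℕ)) r : ℝ) =
          (1 - 1 / (p : ℝ) ^ r) *
            (((p : ℝ) ^ m + 1 / 2 * ((c₁ : ℝ) - 9 * |(d₁ : ℝ)|) * ((p : ℝ) ^ m) ^ (1 / 3 : ℝ)) /
              (N : ℝ))) := by
  have hp' := (Fact.out : p.Prime)
  have hpZ : Prime (p : ℤ) := Nat.prime_iff_prime_int.1 hp'
  have hgeom := Nat.geomSum_eq hp'.two_le m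
  set L := (p ^ m - 1) / (p - 1) with hL
  have hLdvd : 3 ∣ L := hN₁ ▸ Nat.gcd_dvd_right _ _
  -- `L` is the sum of `m` powers of `p`, each `≡ 1 (mod 3)`.
  have hLm : L ≡ m [MOD 3] := by
    rw [← hgeom]
    have : ∀ m : ℕ, ∑ i ∈ range m, p ^ i ≡ m [MOD 3] := by
      intro m
      induction m with
      | zero => rfl
      | succ m ih =>
        rw [sum_range_succ]
        exact ih.add (by simpa using hp.pow m)
    exact this m
  have h3m : 3 ∣ m := (hLm.dvd_iff dvd_rfl).1 hLdvd
  refine ⟨h3m, ?_⟩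
  obtain ⟨l, rfl⟩ := h3m
  have hrl : r ≤ l := by
    push_cast at hrm
    have : (r : ℝ) ≤ l := by linarith
    exact_mod_cast this
  have hl0 : l ≠ 0 := by omega
  obtain ⟨e, he⟩ : 3 ∣ p - 1 := (Nat.modEq_iff_dvd' hp'.one_lt.le).1 hp.symm
  have hpow1 : 1 ≤ p ^ (3 * l) := Nat.one_le_pow _ _ hp'.pos
  have hLmul : (p - 1) * L = p ^ (3 * l) - 1 := by
    rw [hL]
    exact Nat.mul_div_cancel' (by simpa using Nat.sub_dvd_pow_sub_pow p 1 (3 * l))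
  obtain ⟨L', hL'⟩ := hLdvd
  set k := e * L with hkdef
  have hk : Fintype.card F = 3 * k + 1 := by
    rw [hF, hkdef, ← mul_assoc, ← he, hLmul]
    omega
  have hpk : p - 1 ∣ k := ⟨L', by rw [hkdef, he, hL']; ring⟩
  have hNn : N * n₁ = 3 * k := by
    rw [hN, Nat.div_mul_cancel ((Nat.modEq_iff_dvd' hpow1).1 hm.1.2.symm), ← hF, hk, Nat.add_sub_cancel]
  have hgcd : Nat.gcd N ((Fintype.card F - 1) / (p - 1)) = 3 := by rw [hF]; exact hN₁
  choose A hA1 hA using fun a : F =>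
    let ⟨A, h1, h2, _⟩ := exists_int_reducedCubicPeriod (p := p) hk hpk a
    (⟨A, h1, h2⟩ : ∃ A : ℤ, A ≡ 1 [ZMOD 3] ∧
      (A : ℂ) = reducedCubicPeriod k (traceAddChar p F) a)
  obtain ⟨hcub, a₀, a₁, a₂, h₀, h₁, h₂, hs, he2, hall⟩ :=
    reducedCubicPeriod_cubic hk (traceAddChar_isPrimitive p F)
  have htF := sum_cubicIndicator_cast_field hk
  set t := ∑ x : F, cubicIndicator F k (x * (1 - x))
  simp only [← hA, hF] at hcub hs he2 hall
  have ht0 : ¬ (p : ℤ) ∣ t := by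
    have : CharP F p := charP_of_injective_algebraMap (algebraMap (ZMod p) F).injective p
    rw [← CharP.intCast_eq_zero_iff F p, htF]
    refine mul_ne_zero (pow_ne_zero _ (neg_ne_zero.2 one_ne_zero)) ?_
    rw [Ne, CharP.cast_eq_zero_iff F p, hkdef, ← hgeom]
    have := hp'.two_le
    -- Every base-`p` digit of `k` is `e = (p - 1) / 3`, so `2 e < p`.
    exact not_dvd_choose_of_geometric (by omega) _
  have hQ0 : ((p : ℤ) ^ l) ≠ 0 := pow_ne_zero _ hpZ.ne_zero
  have hc : ∀ a, a ≠ 0 → ∃ c, A a = (p : ℤ) ^ l * c ∧ ¬ (p : ℤ) ∣ c := fun a ha =>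
    exists_eq_pow_mul_of_cubic_eq hpZ ht0 (by exact_mod_cast hcub a ha)
  have hQ3 : (p : ℤ) ^ l ≡ 1 [ZMOD 3] := by
    have : (p : ℤ) ≡ 1 [ZMOD 3] := by exact_mod_cast (Int.natCast_modEq_iff.2 hp)
    simpa using this.pow l
  have hc3 : ∀ a c, A a = (p : ℤ) ^ l * c → c ≡ 1 [ZMOD 3] := by
    intro a c h
    have h1 := hA1 a
    rw [h] at h1
    have h2 := hQ3.mul_right c
    rw [one_mul] at h2
    exact h2.symm.trans h1
  obtain ⟨c₀, hc₀, hpc₀⟩ := hc a₀ h₀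
  obtain ⟨c₁, hc₁, hpc₁⟩ := hc a₁ h₁
  obtain ⟨c₂, hc₂, hpc₂⟩ := hc a₂ h₂
  have hs' : c₀ + c₁ + c₂ = 0 := by
    have : A a₀ + A a₁ + A a₂ = 0 := by exact_mod_cast hs
    rw [hc₀, hc₁, hc₂, ← mul_add, ← mul_add] at this
    exact (mul_eq_zero.1 this).resolve_left hQ0
  have he2' : c₀ * c₁ + c₀ * c₂ + c₁ * c₂ = -(3 * (p : ℤ) ^ l) := by
    have : A a₀ * A a₁ + A a₀ * A a₂ + A a₁ * A a₂ = -(3 * (p : ℤ) ^ (3 * l)) := by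
      exact_mod_cast he2
    rw [hc₀, hc₁, hc₂] at this
    refine mul_left_cancel₀ (pow_ne_zero 2 hQ0) ?_
    rw [mul_comm 3 l, pow_mul] at this
    linear_combination this
  obtain ⟨c, d, x, y, hrep, hx, hy, hiff⟩ := exists_cubic_representation (hc3 _ _ hc₀)
    (hc3 _ _ hc₁) (hc3 _ _ hc₂) hs' he2'
  have hval : ∀ z, z = c ∨ z = x ∨ z = y → ∃ a, a ≠ 0 ∧ A a = (p : ℤ) ^ l * z := by
    intro z hz
    rcases (hiff z).2 hz with rfl | rfl | rfl
    · exact ⟨a₀, h₀, hc₀⟩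
    · exact ⟨a₁, h₁, hc₁⟩
    · exact ⟨a₂, h₂, hc₂⟩
  have hval' : ∀ a, a ≠ 0 → ∃ z, (z = c ∨ z = x ∨ z = y) ∧ A a = (p : ℤ) ^ l * z := by
    intro a ha
    rcases hall a ha with h | h | h
    · exact ⟨c₀, (hiff _).1 (by simp), by rw [← hc₀]; exact_mod_cast h⟩
    · exact ⟨c₁, (hiff _).1 (by simp), by rw [← hc₁]; exact_mod_cast h⟩
    · exact ⟨c₂, (hiff _).1 (by simp), by rw [← hc₂]; exact_mod_cast h⟩
  have hcprop : c ≡ 1 [ZMOD 3] ∧ ¬ (p : ℤ) ∣ c := by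
    rcases (hiff c).2 (by simp) with h | h | h <;> rw [h]
    · exact ⟨hc3 _ _ hc₀, hpc₀⟩
    · exact ⟨hc3 _ _ hc₁, hpc₁⟩
    · exact ⟨hc3 _ _ hc₂, hpc₂⟩
  have hgcd1 : ∀ z : ℤ, Int.gcd z p = 1 ↔ ¬ (p : ℤ) ∣ z := by
    intro z
    rw [← Int.isCoprime_iff_gcd_eq_one, isCoprime_comm, hpZ.coprime_iff_not_dvd]
  -- The `p`-adic valuation of `A a` is `l`, less than `3 l`.
  have hAne : ∀ a, a ≠ 0 → A a ≠ (p : ℤ) ^ (3 * l) := by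
    intro a ha h
    obtain ⟨z, hz, hpz⟩ := hc a ha
    apply hpz
    rw [hz, show (p : ℤ) ^ (3 * l) = p ^ l * p ^ (2 * l) by rw [← pow_add]; congr 1; ring] at h
    rw [mul_left_cancel₀ hQ0 h]
    exact dvd_pow_self _ (by omega)
  have hrpow : ((p : ℝ) ^ (3 * l)) ^ (1 / 3 : ℝ) = (p : ℝ) ^ l := by
    rw [mul_comm, pow_mul, ← Real.rpow_natCast ((p : ℝ) ^ l), ← Real.rpow_mul (by positivity)]
    norm_num
  have hQpos : (0 : ℤ) < (p : ℤ) ^ l := by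
    have := hp'.pos
    positivity
  have hweight : ∀ M : ℤ, (M = c ∨ M = x ∨ M = y) → c ≤ M → x ≤ M → y ≤ M →
      (generalizedHammingWeight
          (traceCode p fun i : Fin n₁ => ((α ^ N : Fˣ) : F) ^ (i : ℕ)) r : ℝ) =
        (1 - 1 / (p : ℝ) ^ r) * (((p : ℝ) ^ (3 * l) - p ^ l * M) / N) := by
    intro M hM hcM hxM hyM
    obtain ⟨a, ha, haM⟩ := hval M hM
    rw [generalizedHammingWeight_traceCode_eq hF hk hpk hp hr hrl hgcd hNn hα hA hAne ha
      fun b hb => ?_, haM]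
    · push_cast
      rfl
    · obtain ⟨z, hz, hbz⟩ := hval' b hb
      rw [haM, hbz]
      refine mul_le_mul_of_nonneg_left ?_ hQpos.le
      rcases hz with rfl | rfl | rfl <;> assumption
  refine ⟨c, d, ⟨?_, hcprop.1, (hgcd1 c).2 hcprop.2⟩, ?_, ?_, ?_⟩
  · rw [Nat.mul_div_cancel_left l (by norm_num)]
    exact hrep
  · rintro c' d' ⟨h1, h2, h3⟩
    rw [Nat.mul_div_cancel_left l (by norm_num)] at h1
    refine cubic_representation_unique hpZ ?_ hrep h1 hcprop.1 h2 hcprop.2 ((hgcd1 c').1 h3)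
    intro h
    have := Nat.le_of_dvd (by norm_num)
      (Int.natCast_dvd_natCast.1 (by exact_mod_cast h : (p : ℤ) ∣ (2 : ℕ)))
    have := hp'.two_le
    obtain ⟨j, hj⟩ := hp_odd
    omega
  -- Both `x ≤ c` and `y ≤ c` reduce to `3 |d| ≤ c`. Otherwise the largest value is `(9 |d| - c) /
  -- 2`, which is `y` or `x` according to the sign of `d`.
  · intro h
    have h1 := neg_abs_le d
    have h2 := le_abs_self d
    rw [hweight c (by simp) le_rfl (by omega) (by omega), hrpow, mul_comm ((p : ℝ) ^ l)]
  · intro h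
    rw [hrpow]
    rcases le_total 0 d with hd | hd
    · rw [abs_of_nonneg hd] at h
      rw [hweight y (by simp) (by omega) (by omega) le_rfl,
        abs_of_nonneg (by exact_mod_cast hd : (0 : ℝ) ≤ d)]
      have : (2 : ℝ) * y = -(c - 9 * d) := by exact_mod_cast hy
      rw [show (y : ℝ) = -(c - 9 * d) / 2 by linarith]
      ring
    · rw [abs_of_nonpos hd] at h
      rw [hweight x (by simp) (by omega) le_rfl (by omega),
        abs_of_nonpos (by exact_mod_cast hd : (d : ℝ) ≤ 0)]
      have : (2 : ℝ) * x = -(c + 9 * d) := by exact_mod_cast hx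
      rw [show (x : ℝ) = -(c + 9 * d) / 2 by linarith]
      ring
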